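/- All relational structures are finite, over finite vocabularies. A homomorphism $h$ from $\mathcal A$ to $\mathcal B$ maps the universe $A$ to $B$ and every tuple of every relation $R^{\mathcal A}$ into $R^{\mathcal B}$; $\mathcal A^{\mathcal B}$ is the set of all of them and $\mathcal A^{\mathcal B}[O]$ the set of their restrictions to $O\subseteq A$. A substructure of $\mathcal A$ has a subset of the universe and subsets of the relations; a core of $\mathcal A$ is a minimal substructure to which $\mathcal A$ maps homomorphically. The hypergraph $\mathcal H_{\mathcal A}$ has node set $A$ and the sets of elements of the tuples of $\mathcal A$ as hyperedges; it is connected if any two nodes are linked by a chain of hyperedges and no hyperedge is empty. Write $\mathcal H_1\le\mathcal H_2$ if every hyperedge of $\mathcal H_1$ is contained in a hyperedge of $\mathcal H_2$. The pair $(\mathcal H_1,\mathcal H_2)$ has a tree projection if $\mathcal H_1\le\mathcal H_a\le\mathcal H_2$ for some acyclic $\mathcal H_a$, i.e. some $\mathcal H_a$ that has a join tree. A view structure for $\mathcal A$ is a structure $\mathcal A_{\mathcal V}$ with universe $A$, over a vocabulary disjoint from that of $\mathcal A$, each of whose relations consists of one tuple (the scope of that view), and such that each tuple $t\in R^{\mathcal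 A}$ has a base view $R_t$ with $R_t^{\mathcal A_{\mathcal V}}=\{t\}$. A structure $\mathcal B_{\mathcal V}$ over the vocabulary of $\mathcal A_{\mathcal V}$ is legal with respect to $\mathcal A_{\mathcal V}$ and $(\mathcal A,\mathcal B)$ if the relation of every view contains the images of its scope under all $h\in\mathcal A^{\mathcal B}$, and $R_t^{\mathcal B_{\mathcal V}}\subseteq R^{\mathcal B}$ for every base view. A decomposition method DM consists of a map $\ell\text{-DM}$, sending each structure $\mathcal A$ to a view structure for $\mathcal A$, and a map $r\text{-DM}$, sending each pair $(\mathcal A,\mathcal B)$ of structures over the same vocabulary to a structure that is legal with respect to $\ell\text{-DM}(\mathcal A)$ and $(\mathcal A,\mathcal B)$. (No computability of these maps is needed here.) The pair $(\mathcal A,O)$ is tp-covered through DM if there is a core $\mathcal A'$ of $\mathcal A\uplus\biguplus_{X\in O}\mathbb S_{\{X\}}$ such that $(\mathcal H_{\mathcal A'},\mathcal H_{\ell\text{-DM}(\mathcal A)})$ has a tree projection, where $\mathbb S_{\{X\}}$ has universe $\{X\}$ and a fresh unary relation $\{\langle X\rangle\}$. A domain-restricted version of $(\mathcal A,\mathcal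 B,O)$ is a pair $(\mathcal A_1,\mathcal B_1)$ with the same universes that expands $(\mathcal A,\mathcal B)$ by unary symbols for output variables only, such that each $X\in O$ has a symbol $\mathrm{dom}(X)$ (new or old) with $\mathrm{dom}(X)^{\mathcal A_1}=\{\langle X\rangle\}$, and $\langle h(X)\rangle\in\mathrm{dom}(X)^{\mathcal B_1}$ for all $h\in\mathcal A^{\mathcal B}$ and $X\in O$ (so no solution is lost). Given views $\mathcal A_{\mathcal V}$ and $\mathcal B_{\mathcal V}$, $\mathrm{GAC}(\mathcal A_{\mathcal V},\mathcal B_{\mathcal V})$ is obtained from $\mathcal B_{\mathcal V}$ by shrinking its relations to the largest ones such that any two views with common variables allow exactly the same assignments to their common variables. The algorithm $\mathrm{ComputeAllSolutions}_{\mathrm{DM}}$, on input $(\mathcal A,\mathcal B,O)$ with $O=\{X_1,\dots,X_m\}$, replaces $(\mathcal A,\mathcal B)$ by any domain-restricted version $(\mathcal A_1,\mathcal B_1)$, and calls $\mathrm{Propagate}(1,\mathcal B_{\mathcal V},\langle\rangle)$, with $\mathcal A_{\mathcal V}=\ell\text{-DM}(\mathcal A_1)$ and $\mathcal B_{\mathcal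 V}=r\text{-DM}(\mathcal A_1,\mathcal B_1)$. The procedure $\mathrm{Propagate}(i,\mathcal B_{\mathcal V},\langle a_1,\dots,a_{i-1}\rangle)$ computes $\mathcal B'_{\mathcal V}=\mathrm{GAC}(\mathcal A_{\mathcal V},\mathcal B_{\mathcal V})$ and, for each $a_i$ in the relation of $\mathcal B'_{\mathcal V}$ for the base view of $\mathrm{dom}(X_i)$: if $i=m$, it outputs $\langle a_1,\dots,a_m\rangle$; otherwise it replaces that relation by $\{\langle a_i\rangle\}$ in $\mathcal B'_{\mathcal V}$ and calls $\mathrm{Propagate}(i+1,\mathcal B'_{\mathcal V},\langle a_1,\dots,a_i\rangle)$. **Theorem.** Let DM be a decomposition method, let $\mathcal A$ be a structure with connected hypergraph $\mathcal H_{\mathcal A}$, and let $O\subseteq A$ be non-empty. Assume that $(\mathcal A,O)$ is tp-covered through DM. Then for every structure $\mathcal B$ over the vocabulary of $\mathcal A$, every enumeration $X_1,\dots,X_m$ of $O$ without repetitions, and every domain-restricted version $(\mathcal A_1,\mathcal B_1)$ that the algorithm may use and for which $\mathcal H_{\ell\text{-DM}(\mathcal A)}\le\mathcal H_{\ell\text{-DM}(\mathcal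 A_1)}$ (adding the domain constraints loses no view; trivially true if $\mathcal A_1=\mathcal A$), $\mathrm{ComputeAllSolutions}_{\mathrm{DM}}$ outputs exactly the tuples $\langle s(X_1),\dots,s(X_m)\rangle$ with $s\in\mathcal A^{\mathcal B}[O]$, each of them once; that is, it computes $\mathcal A^{\mathcal B}[O]$. -/

import Mathlib

/-- A vocabulary: a finite set of relation symbols of specified arities. -/
structure Vocabulary where
  Sym : Type
  fin : Finite Sym
  arity : Sym → ℕ

/-- The disjoint union of two vocabularies. -/
def Vocabulary.sum (σ τ : Vocabulary) : Vocabulary where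
  Sym := σ.Sym ⊕ τ.Sym
  fin := by
    have := σ.fin
    have := τ.fin
    infer_instance
  arity := Sum.elim σ.arity τ.arity

/-- The vocabulary with one (fresh) unary relation symbol for every element of `O`. -/
def Vocabulary.unary {V : Type} (O : Finset V) : Vocabulary where
  Sym := {x : V // x ∈ O}
  fin := inferInstance
  arity := fun _ => 1

/-- A finite relational structure over `τ`. Its universe `carrier` is a finite subset of an ambient
type `V`; a tuple of an `r`-ary relation is a list of length `r` of elements of the universe. -/
@[ext]
structure RelStr (τ : Vocabulary) (V : Type) where
  carrier : Finset V
  rel : τ.Sym → Set (List V)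
  length_eq : ∀ R, ∀ t ∈ rel R, t.length = τ.arity R
  mem_carrier : ∀ R, ∀ t ∈ rel R, ∀ x ∈ t, x ∈ carrier

namespace RelStr

variable {σ τ : Vocabulary} {V W : Type}

/-- `h` is a homomorphism from `A` to `B`. Only the values of `h` on the universe of `A` matter. -/
def IsHom (A : RelStr τ V) (B : RelStr τ W) (h : V → W) : Prop :=
  (∀ x ∈ A.carrier, h x ∈ B.carrier) ∧ ∀ R, ∀ t ∈ A.rel R, t.map h ∈ B.rel R

/-- The restrictions to `O` of all homomorphisms from `A` to `B`. -/
def solutionsOn (A : RelStr τ V) (B : RelStr τ W) (O : Finset V) : Set ({x : V // x ∈ O} → W) :=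
  {s | ∃ h : V → W, IsHom A B h ∧ ∀ x, s x = h x.1}

/-- `A'` is a (not necessarily induced) substructure of `A`. -/
def IsSubstructure (A' A : RelStr τ V) : Prop :=
  A'.carrier ⊆ A.carrier ∧ ∀ R, A'.rel R ⊆ A.rel R

/-- `A'` is a core of `A`: a minimal substructure of `A` to which `A` maps homomorphically. -/
def IsCore (A' A : RelStr τ V) : Prop :=
  IsSubstructure A' A ∧ (∃ h, IsHom A A' h) ∧
    ∀ A'' : RelStr τ V, IsSubstructure A'' A' → A'' ≠ A' → ¬ ∃ h, IsHom A A'' h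

open Classical in
/-- The union `A ⊎ A'` of two structures over disjoint vocabularies. Their universes may overlap. -/
noncomputable def union (A : RelStr σ V) (A' : RelStr τ V) : RelStr (σ.sum τ) V where
  carrier := A.carrier ∪ A'.carrier
  rel := Sum.elim A.rel A'.rel
  length_eq := by
    rintro (R | R) t ht
    · exact A.length_eq R t ht
    · exact A'.length_eq R t ht
  mem_carrier := by
    rintro (R | R) t ht x hx
    · exact Finset.mem_union_left _ (A.mem_carrier R t ht x hx)
    · exact Finset.mem_union_right _ (A'.mem_carrier R t ht x hx)

/-- The union over all `X ∈ O` of the structures with universe `{X}` and with the single relation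
`{⟨X⟩}`, named by a fresh unary relation symbol. -/
def singletons (O : Finset V) : RelStr (Vocabulary.unary O) V where
  carrier := O
  rel := fun X => {[X.1]}
  length_eq := by
    rintro R t rfl
    rfl
  mem_carrier := by
    rintro R t rfl x hx
    rw [List.mem_singleton] at hx
    exact hx ▸ R.2

/-- The hypergraph of a structure: its nodes are the elements of the universe and its hyperedges
are the sets of elements of the tuples. -/
def hypergraph (A : RelStr τ V) : Hypergraph V where
  vertexSet := {x | x ∈ A.carrier}
  edgeSet := {e | ∃ R, ∃ t ∈ A.rel R, e = {x | x ∈ t}}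
  subset_vertexSet_of_mem_edgeSet' := by
    rintro e ⟨R, t, ht, rfl⟩ x hx
    exact A.mem_carrier R t ht x hx

end RelStr

/-- Every hyperedge of `H₁` is contained in some hyperedge of `H₂`. -/
def Hypergraph.CoveredBy {V : Type} (H₁ H₂ : Hypergraph V) : Prop :=
  ∀ e ∈ H₁.edgeSet, ∃ f ∈ H₂.edgeSet, e ⊆ f

/-- `T` is a join tree of `H`. (Preconnected rather than connected, so that a hypergraph without
hyperedges has the empty join tree.) -/
def Hypergraph.IsJoinTree {V : Type} (H : Hypergraph V)
    (T : SimpleGraph {e : Set V // e ∈ H.edgeSet}) : Prop :=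
  T.Preconnected ∧ T.IsAcyclic ∧
    ∀ e f : {e : Set V // e ∈ H.edgeSet}, ∀ x, x ∈ e.1 → x ∈ f.1 →
      ∀ p : T.Walk e f, p.IsPath → ∀ g ∈ p.support, x ∈ g.1

/-- Acyclicity of hypergraphs: existence of a join tree. -/
def Hypergraph.Acyclic {V : Type} (H : Hypergraph V) : Prop :=
  ∃ T, H.IsJoinTree T

/-- The pair `(H₁, H₂)` has a tree projection. -/
def Hypergraph.HasTreeProjection {V : Type} (H₁ H₂ : Hypergraph V) : Prop :=
  ∃ H : Hypergraph V, H.Acyclic ∧ H₁.CoveredBy H ∧ H.CoveredBy H₂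

/-- Connectedness of a hypergraph (of its node-hyperedge incidence graph): any two nodes are linked
by a chain of hyperedges, and no hyperedge is empty. -/
def Hypergraph.IsConnected {V : Type} (H : Hypergraph V) : Prop :=
  (∀ x ∈ H.vertexSet, ∀ y ∈ H.vertexSet, Relation.ReflTransGen H.Adj x y) ∧
    ∀ e ∈ H.edgeSet, e.Nonempty

/-- A view structure for `A`. Its vocabulary is a type of its own, hence disjoint from that of `A`;
each of its relations consists of a single tuple, `scope R`; and every tuple `t` of every relation
of `A` has a base view, whose relation is `{t}`. -/
structure ViewStr {τ : Vocabulary} {V : Type} (A : RelStr τ V) where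
  voc : Vocabulary
  str : RelStr voc V
  carrier_eq : str.carrier = A.carrier
  scope : voc.Sym → List V
  rel_eq : ∀ R, str.rel R = {scope R}
  base : ∀ R, ∀ t ∈ A.rel R, voc.Sym
  base_eq : ∀ R t (ht : t ∈ A.rel R), str.rel (base R t ht) = {t}

/-- Legality of the right-hand structure `BV` with respect to the views `AV` and `(A, B)`: every
view contains the restrictions to its variables of all homomorphisms, and every base view is
contained in the original constraint relation. -/
structure ViewStr.IsLegal {τ : Vocabulary} {V W : Type} {A : RelStr τ V} (AV : ViewStr A)
    (B : RelStr τ W) (BV : RelStr AV.voc W) : Prop where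
  complete : ∀ R, ∀ h : V → W, A.IsHom B h → (AV.scope R).map h ∈ BV.rel R
  base_subset : ∀ R t (ht : t ∈ A.rel R), BV.rel (AV.base R t ht) ⊆ B.rel R

/-- A decomposition method: it maps every left-hand structure to a view structure, and every
instance to a legal right-hand structure for these views. -/
structure DecompositionMethod where
  left : ∀ {τ : Vocabulary} {V : Type} (A : RelStr τ V), ViewStr A
  right : ∀ {τ : Vocabulary} {V W : Type} (A : RelStr τ V), RelStr τ W → RelStr (left A).voc W
  legal : ∀ {τ : Vocabulary} {V W : Type} (A : RelStr τ V) (B : RelStr τ W),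
    (left A).IsLegal B (right A B)

/-- `(A, O)` is tp-covered through `DM`. -/
def DecompositionMethod.TPCovered (DM : DecompositionMethod) {τ : Vocabulary} {V : Type}
    (A : RelStr τ V) (O : Finset V) : Prop :=
  ∃ A' : RelStr (τ.sum (Vocabulary.unary O)) V, A'.IsCore (A.union (RelStr.singletons O)) ∧
    A'.hypergraph.HasTreeProjection (DM.left A).str.hypergraph

/-- The tuples of values `b`, `b'` for the tuples of variables `s`, `s'` give the same value to
every variable that `s` and `s'` have in common. -/
def Agree {V W : Type} (s s' : List V) (b b' : List W) : Prop :=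
  ∀ p ∈ s.zip b, ∀ p' ∈ s'.zip b', p.1 = p'.1 → p.2 = p'.2

namespace ViewStr

variable {τ : Vocabulary} {V W : Type} {A : RelStr τ V}

/-- Generalized arc consistency: any two views with some variables in common allow the same tuples
of values on the variables that they have in common. (Taking `R' = R`, this also excludes tuples
that give two values to a variable occurring twice in a scope.) -/
def Consistent (AV : ViewStr A) (C : AV.voc.Sym → Set (List W)) : Prop :=
  ∀ R R', (∃ x, x ∈ AV.scope R ∧ x ∈ AV.scope R') →
    ∀ b ∈ C R, ∃ b' ∈ C R', Agree (AV.scope R) (AV.scope R') b b'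

/-- Enforcing generalized arc consistency: the largest consistent family of subrelations of the
relations of `BV`, which is what filtering the relations until they are consistent yields. -/
def gac (AV : ViewStr A) (BV : RelStr AV.voc W) : RelStr AV.voc W where
  carrier := BV.carrier
  rel := fun R => {b | ∃ C : AV.voc.Sym → Set (List W),
    (∀ R', C R' ⊆ BV.rel R') ∧ AV.Consistent C ∧ b ∈ C R}
  length_eq := by
    rintro R t ⟨C, hC, -, ht⟩
    exact BV.length_eq R t (hC R ht)
  mem_carrier := by
    rintro R t ⟨C, hC, -, ht⟩ x hx
    exact BV.mem_carrier R t (hC R ht) x hx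

/-- The result of enforcing generalized arc consistency is indeed consistent. -/
theorem gac_consistent (AV : ViewStr A) (BV : RelStr AV.voc W) :
    AV.Consistent (AV.gac BV).rel := by
  rintro R R' hx b ⟨C, hC, hcons, hb⟩
  obtain ⟨b', hb', hag⟩ := hcons R R' hx b hb
  exact ⟨b', ⟨C, hC, hcons, hb'⟩, hag⟩

end ViewStr

namespace RelStr

variable {τ : Vocabulary} {W : Type}

open Classical in
/-- The values `a` with `⟨a⟩` in the relation named `R`. -/
noncomputable def values (B : RelStr τ W) (R : τ.Sym) : Finset W :=
  B.carrier.filter (fun a => [a] ∈ B.rel R)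

/-- Replace the relation named `R₀` by `{⟨a⟩}` (used only when it contains `⟨a⟩`). -/
def fix (B : RelStr τ W) (R₀ : τ.Sym) (a : W) : RelStr τ W where
  carrier := B.carrier
  rel := fun R => {t | t ∈ B.rel R ∧ (R = R₀ → t = [a])}
  length_eq := fun R t ht => B.length_eq R t ht.1
  mem_carrier := fun R t ht => B.mem_carrier R t ht.1

end RelStr

/-- A domain-restricted version of the instance `(A, B, O)`: an equivalent instance obtained by
adding, for output variables `X`, a fresh unary constraint `dom X` with the single scope `⟨X⟩`, so
that in the end all output variables have such a constraint (those that already have one need no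
fresh one). The relation of `dom X` may be any set of values that loses no solution, for instance
the projection to `X` of the relation of any constraint in which `X` occurs. -/
structure DomainRestrictedVersion {τ : Vocabulary} {V W : Type} (A : RelStr τ V) (B : RelStr τ W)
    (O : Finset V) where
  voc : Vocabulary
  A₁ : RelStr voc V
  B₁ : RelStr voc W
  old : τ.Sym → voc.Sym
  old_injective : Function.Injective old
  arity_old : ∀ R, voc.arity (old R) = τ.arity R
  carrier_left : A₁.carrier = A.carrier
  carrier_right : B₁.carrier = B.carrier
  rel_left : ∀ R, A₁.rel (old R) = A.rel R
  rel_right : ∀ R, B₁.rel (old R) = B.rel R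
  dom : {x : V // x ∈ O} → voc.Sym
  rel_dom : ∀ X, A₁.rel (dom X) = {[X.1]}
  /-- only domain symbols are added -/
  fresh_dom : ∀ R, R ∉ Set.range old → ∃ X, R = dom X
  /-- no solution is lost -/
  keep : ∀ h : V → W, A.IsHom B h → ∀ X : {x : V // x ∈ O}, [h X.1] ∈ B₁.rel (dom X)

/-- Adding to every output variable `X` a fresh domain constraint with set of values `D X` gives a
domain-restricted version, whenever the sets `D X` lose no solution. -/
noncomputable def DomainRestrictedVersion.ofDomains {τ : Vocabulary} {V W : Type} (A : RelStr τ V)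
    (B : RelStr τ W) (O : Finset V) (hO : O ⊆ A.carrier) (D : V → Set W)
    (hD : ∀ h : V → W, A.IsHom B h → ∀ X ∈ O, h X ∈ D X) :
    DomainRestrictedVersion A B O where
  voc := τ.sum (Vocabulary.unary O)
  A₁ := A.union (RelStr.singletons O)
  B₁ :=
    { carrier := B.carrier
      rel := Sum.elim B.rel (fun X => {t | ∃ a ∈ B.carrier, a ∈ D X.1 ∧ t = [a]})
      length_eq := by
        rintro (R | X) t ht
        · exact B.length_eq R t ht
        · obtain ⟨a, -, -, rfl⟩ := ht
          rfl
      mem_carrier := by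
        rintro (R | X) t ht x hx
        · exact B.mem_carrier R t ht x hx
        · obtain ⟨a, ha, -, rfl⟩ := ht
          rw [List.mem_singleton] at hx
          exact hx ▸ ha }
  old := Sum.inl
  old_injective := Sum.inl_injective
  arity_old := fun _ => rfl
  carrier_left := by
    classical
    ext x
    simp only [RelStr.union, RelStr.singletons, Finset.mem_union]
    exact ⟨fun h => h.elim id (fun h => hO h), Or.inl⟩
  carrier_right := rfl
  rel_left := fun _ => rfl
  rel_right := fun _ => rfl
  dom := Sum.inr
  rel_dom := fun _ => rfl
  fresh_dom := by
    rintro (R | X) hR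
    · exact absurd ⟨R, rfl⟩ hR
    · exact ⟨X, rfl⟩
  keep := fun h hh X => ⟨h X.1, hh.1 _ (hO X.2), hD h hh X.1 X.2, rfl⟩

/-- The procedure `Propagate`. The first list contains the output variables `X_i, …, X_m` still to
be assigned, `BV` is the current right-hand structure for the views, and `pre` is the tuple
`⟨a_1, …, a_{i-1}⟩`. The result is the multiset of the tuples that are output. (There is no call
with an empty first list if `m ≥ 1`.) -/
noncomputable def ViewStr.propagate {τ : Vocabulary} {V W : Type} {A : RelStr τ V} (AV : ViewStr A)
    {O : Finset V} (dom : {x : V // x ∈ O} → AV.voc.Sym) :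
    List {x : V // x ∈ O} → RelStr AV.voc W → List W → Multiset (List W)
  | [], _, _ => 0
  | X :: Xs, BV, pre =>
    let BV' := AV.gac BV
    let activeValues := BV'.values (dom X)
    activeValues.val.bind fun a =>
      if Xs.isEmpty then {pre ++ [a]}
      else AV.propagate dom Xs (BV'.fix (dom X) a) (pre ++ [a])

/-- The base view of the domain constraint of the output variable `X`. -/
def DecompositionMethod.domView (DM : DecompositionMethod) {τ : Vocabulary} {V W : Type}
    {A : RelStr τ V} {B : RelStr τ W} {O : Finset V} (I : DomainRestrictedVersion A B O)
    (X : {x : V // x ∈ O}) : (DM.left I.A₁).voc.Sym :=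
  (DM.left I.A₁).base (I.dom X) [X.1] ((I.rel_dom X).symm ▸ Set.mem_singleton _)

/-- The algorithm `ComputeAllSolutions`, run with the domain-restricted version `I` of the input
`(A, B, O)` and with the enumeration `Xs = X_1, …, X_m` of `O`: the multiset of its outputs. -/
noncomputable def DecompositionMethod.computeAllSolutions (DM : DecompositionMethod)
    {τ : Vocabulary} {V W : Type} {A : RelStr τ V} {B : RelStr τ W} {O : Finset V}
    (I : DomainRestrictedVersion A B O) (Xs : List {x : V // x ∈ O}) : Multiset (List W) :=
  (DM.left I.A₁).propagate (DM.domView I) Xs (DM.right I.A₁ I.B₁) []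

/-! Soundness is the main point. The values chosen on a branch are all checked against one family:
the relations left by the last GAC, where the domain views of the earlier output variables allow
only their chosen values. So it suffices that one allowed value of the last variable extends to a
solution whose values on all of `O` are allowed by that family (`TPCovered.exists_isHom`).

Let `A'` be the core and `H` the tree projection. Starting at the given value, consistency carries
tuples along the join tree of `H`, and the running intersection property glues them to an assignment
`h` on the component of the variable (`Consistent.exists_extension`). A homomorphism `g` onto `A'`
transfers connectedness from `A`, so `h` satisfies every constraint in `A'`. The fresh unary
relations force `g` to fix `O`, hence `h ∘ g` is a solution with the values of `h` on `O`.

Conversely, the images of the scopes under a solution form a consistent family, which GAC never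
removes. -/

/-! ### Labellings of acyclic graphs -/

/-- Transport a value backwards along a walk, from its end to its start. -/
def SimpleGraph.Walk.transportBack {E β : Type*} {G : SimpleGraph E} (step : E → E → β → β)
    (b₀ : β) : ∀ {u v : E}, G.Walk u v → β
  | _, _, .nil => b₀
  | _, _, .cons (u := u) (v := v) _ p => step v u (p.transportBack step b₀)

/-- In an acyclic graph, if good labels can be extended compatibly along every edge, then a good
label of `r` extends to a labelling that is good and compatible on the component of `r`. -/
theorem SimpleGraph.IsAcyclic.exists_compatible_labelling {E β : Type*} {G : SimpleGraph E}
    (hG : G.IsAcyclic) (good : E → β → Prop) (compat : E → E → β → β → Prop)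
    (hsymm : ∀ u v b c, compat u v b c → compat v u c b)
    (hext : ∀ u v b, G.Adj u v → good u b → ∃ c, good v c ∧ compat u v b c)
    (r : E) (b₀ : β) (h₀ : good r b₀) :
    ∃ f : E → β, f r = b₀ ∧ (∀ u, G.Reachable u r → good u (f u)) ∧
      ∀ u v, G.Adj u v → G.Reachable u r → compat u v (f u) (f v) := by
  classical
  -- The default `b` is never used on good labels along edges.
  let step : E → E → β → β := fun u v b =>
    if h : ∃ c, good v c ∧ compat u v b c then h.choose else b
  have hstep : ∀ u v b, G.Adj u v → good u b →
      good v (step u v b) ∧ compat u v b (step u v b) := by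
    intro u v b huv hb
    have h := hext u v b huv hb
    simp only [step, dif_pos h]
    exact h.choose_spec
  have hgood : ∀ {u w : E} (p : G.Walk u w), good w b₀ → good u (p.transportBack step b₀) := by
    intro u w p hw
    induction p with
    | nil => exact hw
    | cons h p ih => exact (hstep _ _ _ h.symm (ih hw)).1
  -- Paths in an acyclic graph are unique, so the choice of path is immaterial.
  let f : E → β := fun u =>
    if h : G.Reachable u r then (h.some.toPath : G.Walk u r).transportBack step b₀ else b₀
  have hf : ∀ u (p : G.Walk u r), p.IsPath → f u = p.transportBack step b₀ := by
    intro u p hp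
    have h : G.Reachable u r := ⟨p⟩
    simp only [f, dif_pos h]
    rw [(hG.subsingleton_path u r).elim h.some.toPath ⟨p, hp⟩]
  refine ⟨f, ?_, ?_, ?_⟩
  · exact hf r .nil .nil
  · rintro u ⟨p⟩
    rw [hf u _ p.toPath.2]
    exact hgood _ h₀
  · have key : ∀ u v (p : G.Walk v r), G.Adj u v → p.IsPath → u ∉ p.support →
        compat v u (f v) (f u) := by
      intro u v p huv hp hu
      rw [hf v p hp, hf u (.cons huv p) (hp.cons hu)]
      exact (hstep _ _ _ huv.symm (hgood p h₀)).2
    rintro u v huv ⟨p⟩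
    by_cases hv : v ∈ (p.toPath : G.Walk u r).support
    -- Here the path from `u` to `r` begins with the edge to `v`, so its remainder avoids `u`.
    · have hq := p.toPath.2.dropUntil hv
      refine hsymm _ _ _ _ (key u v _ huv hq fun hu => ?_)
      have hq' := (hG.subsingleton_path u v).elim ⟨_, p.toPath.2.takeUntil hv⟩
        ⟨.cons huv .nil, by simp [huv.ne]⟩
      have hnil := p.toPath.2
      rw [← (p.toPath : G.Walk u r).take_spec hv, Subtype.mk.inj hq'] at hnil
      simp only [SimpleGraph.Walk.cons_append, SimpleGraph.Walk.nil_append,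
        SimpleGraph.Walk.cons_isPath_iff] at hnil
      exact hnil.2 hu
    · exact key v u _ huv.symm p.toPath.2 hv

/-! ### Agreement of tuples and covering of hypergraphs -/

theorem Agree.symm {V W : Type} {s s' : List V} {b b' : List W} (h : Agree s s' b b') :
    Agree s' s b' b :=
  fun p hp p' hp' e => (h p' hp' p hp e.symm).symm

theorem List.exists_mem_zip_of_mem_left {α β : Type*} {l : List α} {l' : List β}
    (h : l'.length = l.length) {x : α} (hx : x ∈ l) : ∃ y, (x, y) ∈ l.zip l' := by
  rw [← List.map_fst_zip h.ge] at hx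
  obtain ⟨⟨_, y⟩, hy, rfl⟩ := List.mem_map.1 hx
  exact ⟨y, hy⟩

theorem List.eq_map_of_forall_mem_zip {α β : Type*} {f : α → β} :
    ∀ {l : List α} {l' : List β}, l'.length = l.length →
      (∀ p ∈ l.zip l', p.2 = f p.1) → l' = l.map f
  | [], [], _, _ => rfl
  | x :: l, y :: l', hlen, h => by
    have hy : y = f x := h (x, y) (by simp)
    rw [List.map_cons, hy,
      eq_map_of_forall_mem_zip (l := l) (l' := l') (by simpa using hlen)
        fun p hp => h p (by simp [hp])]

theorem Hypergraph.CoveredBy.adj {V : Type} {H₁ H₂ : Hypergraph V} (h : H₁.CoveredBy H₂) {x y : V}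
    (hxy : H₁.Adj x y) : H₂.Adj x y := by
  obtain ⟨e, he, hx, hy⟩ := hxy
  obtain ⟨f, hf, hef⟩ := h e he
  exact ⟨f, hf, hef hx, hef hy⟩

theorem Hypergraph.CoveredBy.trans {V : Type} {H₁ H₂ H₃ : Hypergraph V} (h : H₁.CoveredBy H₂)
    (h' : H₂.CoveredBy H₃) : H₁.CoveredBy H₃ := by
  intro e he
  obtain ⟨f, hf, hef⟩ := h e he
  obtain ⟨g, hg, hfg⟩ := h' f hf
  exact ⟨g, hg, hef.trans hfg⟩

/-! ### Consistent views over an acyclic hypergraph -/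

namespace ViewStr

variable {τ : Vocabulary} {V W : Type} {A : RelStr τ V}

theorem scope_base (AV : ViewStr A) (R : τ.Sym) (t : List V) (ht : t ∈ A.rel R) :
    AV.scope (AV.base R t ht) = t := by
  have h := AV.base_eq R t ht
  rw [AV.rel_eq] at h
  exact Set.singleton_injective h

theorem length_scope (AV : ViewStr A) (R : AV.voc.Sym) :
    (AV.scope R).length = AV.voc.arity R :=
  AV.str.length_eq R _ (by rw [AV.rel_eq]; rfl)

theorem exists_scope_of_mem_edgeSet (AV : ViewStr A) {e : Set V}
    (he : e ∈ AV.str.hypergraph.edgeSet) : ∃ R, e = {x | x ∈ AV.scope R} := by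
  obtain ⟨R, t, ht, rfl⟩ := he
  rw [AV.rel_eq] at ht
  exact ⟨R, by rw [Set.mem_singleton_iff.1 ht]⟩

/-- By consistency of `R` with itself, all occurrences of a variable are compared with one and the
same entry of some `b'`. -/
theorem Consistent.agree_self {AV : ViewStr A} {C : AV.voc.Sym → Set (List W)}
    (hC : AV.Consistent C) (hlen : ∀ R, ∀ b ∈ C R, b.length = (AV.scope R).length)
    {R : AV.voc.Sym} {b : List W} (hb : b ∈ C R) : Agree (AV.scope R) (AV.scope R) b b := by
  rintro ⟨x, w⟩ hp ⟨y, w'⟩ hp' (rfl : x = y)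
  have hx : x ∈ AV.scope R := (List.of_mem_zip hp).1
  obtain ⟨b', hb', hag⟩ := hC R R ⟨x, hx, hx⟩ b hb
  obtain ⟨z, hz⟩ := List.exists_mem_zip_of_mem_left (hlen R b' hb') hx
  exact (hag _ hp _ hz rfl).trans (hag _ hp' _ hz rfl).symm

/-- A value allowed by a consistent family extends to all views that are covered by hyperedges of
an acyclic hypergraph covered by the views and that lie in the component of the given variable. -/
theorem Consistent.exists_extension {AV : ViewStr A} {C : AV.voc.Sym → Set (List W)}
    (hC : AV.Consistent C) (hlen : ∀ R, ∀ b ∈ C R, b.length = (AV.scope R).length)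
    {H : Hypergraph V} (hH : H.Acyclic) (hHV : H.CoveredBy AV.str.hypergraph)
    {X : V} {r : Set V} (hr : r ∈ H.edgeSet) (hXr : X ∈ r)
    {R₀ : AV.voc.Sym} {b₀ : List W} (hb₀ : b₀ ∈ C R₀) {a : W}
    (hX : (X, a) ∈ (AV.scope R₀).zip b₀) :
    ∃ h : V → W, h X = a ∧ ∀ R, ∀ e ∈ H.edgeSet, (∀ x ∈ AV.scope R, x ∈ e) →
      ∀ x ∈ AV.scope R, Relation.ReflTransGen H.Adj X x → (AV.scope R).map h ∈ C R := by
  classical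
  obtain ⟨T, hpre, hac, hjoin⟩ := hH
  have hview : ∀ e : {e : Set V // e ∈ H.edgeSet}, ∃ R, ∀ x ∈ e.1, x ∈ AV.scope R := by
    intro e
    obtain ⟨f, hf, hef⟩ := hHV e.1 e.2
    obtain ⟨R, rfl⟩ := AV.exists_scope_of_mem_edgeSet hf
    exact ⟨R, hef⟩
  choose view hview using hview
  -- Consistency says nothing about views without common variables, so tree edges between disjoint
  -- hyperedges are dropped.
  let G : SimpleGraph {e : Set V // e ∈ H.edgeSet} :=
    { Adj := fun e f => T.Adj e f ∧ ∃ x, x ∈ e.1 ∧ x ∈ f.1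
      symm := ⟨fun e f h => ⟨h.1.symm, h.2.imp fun _ hx => hx.symm⟩⟩
      loopless := ⟨fun e h => h.1.ne rfl⟩ }
  have hGac : G.IsAcyclic := hac.anti fun e f h => h.1
  obtain ⟨c₀, hc₀, hag₀⟩ := hC R₀ (view ⟨r, hr⟩)
    ⟨X, (List.of_mem_zip hX).1, hview ⟨r, hr⟩ X hXr⟩ b₀ hb₀
  obtain ⟨f, hfr, hfgood, hfcompat⟩ := hGac.exists_compatible_labelling
    (fun e b => b ∈ C (view e))
    (fun e e' b b' => Agree (AV.scope (view e)) (AV.scope (view e')) b b')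
    (fun _ _ _ _ h => h.symm)
    (fun e e' b hadj hb => hC _ _
      (hadj.2.imp fun x hx => ⟨hview e x hx.1, hview e' x hx.2⟩) b hb)
    ⟨r, hr⟩ c₀ hc₀
  have hexval : ∀ e, G.Reachable e ⟨r, hr⟩ → ∀ x ∈ e.1,
      ∃ w, (x, w) ∈ (AV.scope (view e)).zip (f e) := fun e he x hx =>
    List.exists_mem_zip_of_mem_left (hlen _ _ (hfgood e he)) (hview e x hx)
  -- If `x` lies in every hyperedge of a tree walk, the walk stays in `G` and the value of `x` is
  -- constant along it.
  have hwalk : ∀ {e e' : {e : Set V // e ∈ H.edgeSet}} (p : T.Walk e e') (x : V),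
      (∀ g ∈ p.support, x ∈ g.1) → G.Reachable e ⟨r, hr⟩ → G.Reachable e' ⟨r, hr⟩ ∧
        ∀ w w', (x, w) ∈ (AV.scope (view e)).zip (f e) →
          (x, w') ∈ (AV.scope (view e')).zip (f e') → w = w' := by
    intro e e' p x
    induction p with
    | nil =>
      exact fun _ he => ⟨he, fun w w' hw hw' => hC.agree_self hlen (hfgood _ he) _ hw _ hw' rfl⟩
    | @cons u v _ huv p ih =>
      intro hp he
      have hxu : x ∈ u.1 := hp u (by simp)
      have hxv : x ∈ v.1 := hp v (by simp)
      have hG : G.Adj u v := ⟨huv, x, hxu, hxv⟩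
      have hv : G.Reachable v ⟨r, hr⟩ := hG.symm.reachable.trans he
      obtain ⟨h1, h2⟩ := ih (fun g hg => hp g (by simp [hg])) hv
      refine ⟨h1, fun w w' hw hw' => ?_⟩
      obtain ⟨z, hz⟩ := hexval v hv x hxv
      exact (hfcompat u v hG he _ hw _ hz rfl).trans (h2 z w' hz hw')
  have hshare : ∀ (e e' : {e : Set V // e ∈ H.edgeSet}) (x : V), x ∈ e.1 → x ∈ e'.1 →
      G.Reachable e ⟨r, hr⟩ → G.Reachable e' ⟨r, hr⟩ ∧
        ∀ w w', (x, w) ∈ (AV.scope (view e)).zip (f e) →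
          (x, w') ∈ (AV.scope (view e')).zip (f e') → w = w' := by
    intro e e' x hx hx' he
    obtain ⟨p⟩ := hpre e e'
    exact hwalk _ x (hjoin e e' x hx hx' _ p.toPath.2) he
  -- Outside the component the value `a` is arbitrary.
  let h : V → W := fun x =>
    if hx : ∃ w, ∃ e, G.Reachable e ⟨r, hr⟩ ∧ x ∈ e.1 ∧
      (x, w) ∈ (AV.scope (view e)).zip (f e) then hx.choose else a
  have hh : ∀ e, G.Reachable e ⟨r, hr⟩ → ∀ x ∈ e.1, ∀ w,
      (x, w) ∈ (AV.scope (view e)).zip (f e) → w = h x := by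
    intro e he x hx w hw
    have hex : ∃ w, ∃ e, G.Reachable e ⟨r, hr⟩ ∧ x ∈ e.1 ∧
      (x, w) ∈ (AV.scope (view e)).zip (f e) := ⟨w, e, he, hx, hw⟩
    simp only [h, dif_pos hex]
    obtain ⟨e', he', hx', hw'⟩ := hex.choose_spec
    exact (hshare e e' x hx hx' he).2 _ _ hw hw'
  have hreach : ∀ x, Relation.ReflTransGen H.Adj X x →
      ∀ e : {e : Set V // e ∈ H.edgeSet}, x ∈ e.1 → G.Reachable e ⟨r, hr⟩ := by
    intro x hx
    induction hx with
    | refl => exact fun e he => (hshare _ e X hXr he .rfl).1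
    | tail _ hyz ih =>
      obtain ⟨g, hg, hy, hz⟩ := hyz
      exact fun e he => (hshare ⟨g, hg⟩ e _ hz he (ih ⟨g, hg⟩ hy)).1
  refine ⟨h, ?_, ?_⟩
  · obtain ⟨w, hw⟩ := hexval ⟨r, hr⟩ .rfl X hXr
    rw [← hh _ .rfl X hXr w hw]
    rw [hfr] at hw
    exact (hag₀ _ hX _ hw rfl).symm
  · intro R e he hRe x hx hXx
    have hes := hreach x hXx ⟨e, he⟩ (hRe x hx)
    -- The scope of `R` lies inside `e`, so agreement with the label of `e` determines all of `b`.
    obtain ⟨b, hb, hag⟩ := hC _ R ⟨x, hview ⟨e, he⟩ x (hRe x hx), hx⟩ _ (hfgood ⟨e, he⟩ hes)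
    rw [← List.eq_map_of_forall_mem_zip (f := h) (hlen R b hb)]
    · exact hb
    · rintro ⟨y, w⟩ hy
      have hye := hRe y (List.of_mem_zip hy).1
      obtain ⟨z, hz⟩ := hexval ⟨e, he⟩ hes y hye
      exact (hag _ hz _ hy rfl).symm.trans (hh _ hes y hye z hz)

end ViewStr

/-! ### Cores and domain-restricted versions -/

namespace RelStr

variable {τ : Vocabulary} {V : Type}

theorem mem_values {B : RelStr τ V} {R : τ.Sym} {a : V} : a ∈ B.values R ↔ [a] ∈ B.rel R := by
  classical
  rw [values, Finset.mem_filter]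
  exact ⟨fun h => h.2, fun h => ⟨B.mem_carrier R _ h a (List.mem_singleton_self a), h⟩⟩

open Classical in
/-- The image of a structure under a map. -/
noncomputable def image (A : RelStr τ V) (g : V → V) : RelStr τ V where
  carrier := A.carrier.image g
  rel := fun R => (fun t => t.map g) '' A.rel R
  length_eq := by
    rintro R _ ⟨t, ht, rfl⟩
    rw [List.length_map]
    exact A.length_eq R t ht
  mem_carrier := by
    rintro R _ ⟨t, ht, rfl⟩ x hx
    obtain ⟨y, hy, rfl⟩ := List.mem_map.1 hx
    exact Finset.mem_image_of_mem g (A.mem_carrier R t ht y hy)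

/-- A core is the image of every homomorphism into it. -/
theorem IsCore.image_eq {A A' : RelStr τ V} (hcore : A'.IsCore A) {g : V → V}
    (hg : A.IsHom A' g) : A.image g = A' := by
  classical
  by_contra hne
  -- The image is a substructure of the core to which `A` still maps, so minimality applies.
  refine hcore.2.2 (A.image g) ⟨fun y hy => ?_, ?_⟩ hne
    ⟨g, fun x hx => Finset.mem_image_of_mem g hx, fun R t ht => ⟨t, ht, rfl⟩⟩
  · obtain ⟨x, hx, rfl⟩ := Finset.mem_image.1 hy
    exact hg.1 x hx
  · rintro R _ ⟨t, ht, rfl⟩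
    exact hg.2 R t ht

end RelStr

namespace DomainRestrictedVersion

variable {τ : Vocabulary} {V W : Type} {A : RelStr τ V} {B : RelStr τ W} {O : Finset V}

theorem isHom (I : DomainRestrictedVersion A B O) {h : V → W} (hh : A.IsHom B h) :
    I.A₁.IsHom I.B₁ h := by
  refine ⟨fun x hx => ?_, fun R t ht => ?_⟩
  · rw [I.carrier_right]
    exact hh.1 x (I.carrier_left ▸ hx)
  · by_cases hR : R ∈ Set.range I.old
    · obtain ⟨R, rfl⟩ := hR
      rw [I.rel_left] at ht
      rw [I.rel_right]
      exact hh.2 R t ht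
    · obtain ⟨X, rfl⟩ := I.fresh_dom R hR
      rw [I.rel_dom] at ht
      rw [Set.mem_singleton_iff.1 ht]
      exact I.keep h hh X

end DomainRestrictedVersion

/-! ### From consistent families to solutions -/

theorem DecompositionMethod.scope_domView (DM : DecompositionMethod) {τ : Vocabulary}
    {V W : Type} {A : RelStr τ V} {B : RelStr τ W} {O : Finset V}
    (I : DomainRestrictedVersion A B O) (X : {x : V // x ∈ O}) :
    (DM.left I.A₁).scope (DM.domView I X) = [X.1] :=
  ViewStr.scope_base _ _ _ _

/-- If `(A, O)` is tp-covered, then every value of an output variable that is allowed by a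
consistent family of subrelations of the views belongs to a solution compatible with the family. -/
theorem DecompositionMethod.TPCovered.exists_isHom {DM : DecompositionMethod} {τ : Vocabulary}
    {V : Type} {A : RelStr τ V} (hA : A.hypergraph.IsConnected) {O : Finset V}
    (hO : O ⊆ A.carrier) (htp : DM.TPCovered A O) {W : Type} {B : RelStr τ W}
    (I : DomainRestrictedVersion A B O)
    (hviews : (DM.left A).str.hypergraph.CoveredBy (DM.left I.A₁).str.hypergraph)
    {C : (DM.left I.A₁).voc.Sym → Set (List W)} (hC : (DM.left I.A₁).Consistent C)
    (hCB : ∀ R, C R ⊆ (DM.right I.A₁ I.B₁).rel R) {X : {x : V // x ∈ O}} {a : W}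
    (ha : [a] ∈ C (DM.domView I X)) :
    ∃ h : V → W, A.IsHom B h ∧ h X.1 = a ∧ ∀ Y, [h Y.1] ∈ C (DM.domView I Y) := by
  classical
  obtain ⟨A', hcore, H, hH, hA'H, hHA⟩ := htp
  obtain ⟨g, hg⟩ := hcore.2.1
  have himage := hcore.image_eq hg
  have hgfix : ∀ Y : {x : V // x ∈ O}, g Y.1 = Y.1 := by
    intro Y
    have h1 := hcore.1.2 _ (hg.2 (Sum.inr Y) [Y.1] rfl)
    exact List.singleton_injective (Set.mem_singleton_iff.1 h1)
  have hdomA' : ∀ Y : {x : V // x ∈ O}, [Y.1] ∈ A'.rel (Sum.inr Y) := by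
    intro Y
    have h1 := hg.2 (Sum.inr Y) [Y.1] rfl
    rwa [List.map_singleton, hgfix] at h1
  -- Fresh symbols go to the domain symbols, which may already be old ones, so injectivity is not
  -- available.
  let old : (τ.sum (Vocabulary.unary O)).Sym → I.voc.Sym := Sum.elim I.old I.dom
  have hold : ∀ R, ∀ t ∈ A'.rel R, t ∈ I.A₁.rel (old R) := by
    rintro (R | Y) t ht
    · exact (I.rel_left R).symm ▸ hcore.1.2 _ ht
    · exact (I.rel_dom Y).symm ▸ hcore.1.2 _ ht
  -- An empty scope meets no component, and consistency would not constrain it.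
  have hnonempty : ∀ R, ∀ t ∈ A'.rel R, ∃ x, x ∈ t := by
    rintro (R | Y) t ht
    · exact hA.2 _ ⟨R, t, hcore.1.2 _ ht, rfl⟩
    · exact ⟨Y.1, by rw [Set.mem_singleton_iff.1 (hcore.1.2 _ ht)]; simp⟩
  have hgA : ∀ x y, A.hypergraph.Adj x y → A'.hypergraph.Adj (g x) (g y) := by
    rintro x y ⟨_, ⟨R, t, ht, rfl⟩, hx, hy⟩
    exact ⟨_, ⟨Sum.inl R, _, hg.2 (Sum.inl R) t ht, rfl⟩,
      List.mem_map_of_mem hx, List.mem_map_of_mem hy⟩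
  -- Elements of the core have the form `g x`, and `g` pushes a chain from `X` to `x` forward while
  -- fixing `X`.
  have hconn : ∀ y ∈ A'.carrier, Relation.ReflTransGen A'.hypergraph.Adj X.1 y := by
    intro y hy
    rw [← himage] at hy
    obtain ⟨x, hx, rfl⟩ := Finset.mem_image.1 hy
    have hxA : x ∈ A.carrier := (Finset.mem_union.1 hx).elim id fun h => hO h
    have h1 : Relation.ReflTransGen A'.hypergraph.Adj (g X.1) (g x) :=
      (hA.1 X.1 (hO X.2) x hxA).lift g hgA
    rwa [hgfix] at h1
  have hlen : ∀ R, ∀ b ∈ C R, b.length = ((DM.left I.A₁).scope R).length := fun R b hb => by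
    rw [ViewStr.length_scope]
    exact RelStr.length_eq _ R b (hCB R hb)
  obtain ⟨r, hr, hXr⟩ := hA'H _ ⟨Sum.inr X, [X.1], hdomA' X, rfl⟩
  obtain ⟨h, hX, hh⟩ := hC.exists_extension hlen hH (hHA.trans hviews) hr
    (hXr (by simp)) ha (X := X.1) (a := a) (by rw [scope_domView]; simp)
  have hbase : ∀ R t (ht : t ∈ A'.rel R),
      t.map h ∈ C ((DM.left I.A₁).base (old R) t (hold R t ht)) := by
    intro R t ht
    obtain ⟨e, he, hte⟩ := hA'H _ ⟨R, t, ht, rfl⟩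
    obtain ⟨x, hx⟩ := hnonempty R t ht
    have h1 := hh ((DM.left I.A₁).base (old R) t (hold R t ht)) e he
    rw [ViewStr.scope_base] at h1
    exact h1 (fun y hy => hte hy) x hx
      (Relation.ReflTransGen.mono (fun _ _ hab => hA'H.adj hab) _ _
        (hconn x (A'.mem_carrier R t ht x hx)))
  have hB₁ : ∀ R, ∀ t ∈ A'.rel R, t.map h ∈ I.B₁.rel (old R) := fun R t ht =>
    (DM.legal I.A₁ I.B₁).base_subset _ _ _ (hCB _ (hbase R t ht))
  -- Values are known to lie in the universe of `B` only through tuples, so each element of the core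
  -- must occur in one.
  have hedge : ∀ y ∈ A'.carrier, ∃ R, ∃ t ∈ A'.rel R, y ∈ t := by
    intro y hy
    rcases Relation.ReflTransGen.cases_tail (hconn y hy) with rfl | ⟨z, -, e, ⟨R, t, ht, rfl⟩, -, hy⟩
    · exact ⟨Sum.inr X, _, hdomA' X, by simp⟩
    · exact ⟨R, t, ht, hy⟩
  refine ⟨h ∘ g, ⟨fun x hx => ?_, fun R t ht => ?_⟩, ?_, fun Y => ?_⟩
  · obtain ⟨R, t, ht, hxt⟩ := hedge (g x) (hg.1 x (Finset.mem_union_left _ hx))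
    rw [← I.carrier_right]
    exact I.B₁.mem_carrier _ _ (hB₁ R t ht) _ (List.mem_map_of_mem hxt)
  · rw [← List.map_map, ← I.rel_right]
    exact hB₁ (Sum.inl R) _ (hg.2 (Sum.inl R) t ht)
  · rw [Function.comp_apply, hgfix, hX]
  · rw [Function.comp_apply, hgfix]
    exact hbase (Sum.inr Y) [Y.1] (hdomA' Y)

/-! ### The outputs of `Propagate` -/

namespace ViewStr

variable {τ : Vocabulary} {V W : Type} {A : RelStr τ V}

theorem gac_rel_subset (AV : ViewStr A) (BV : RelStr AV.voc W) (R : AV.voc.Sym) :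
    (AV.gac BV).rel R ⊆ BV.rel R := by
  rintro b ⟨C, hC, -, hb⟩
  exact hC R hb

/-- Every entry is the value of `h` at its variable, so any two of the tuples agree. -/
theorem consistent_singleton_map (AV : ViewStr A) (h : V → W) :
    AV.Consistent fun R => {(AV.scope R).map h} := by
  have hmap : ∀ (l : List V) (p : V × W), p ∈ l.zip (l.map h) → p.2 = h p.1 := by
    intro l p hp
    rw [List.zip_map_right, List.mem_map] at hp
    obtain ⟨⟨x, y⟩, hq, rfl⟩ := hp
    have : x = y := by
      induction l with
      | nil => simp at hq
      | cons z l ih =>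
        rw [List.zip_cons_cons, List.mem_cons] at hq
        rcases hq with hq | hq
        · rw [Prod.mk_inj] at hq
          exact hq.1.trans hq.2.symm
        · exact ih hq
    simp [this]
  rintro R R' - b rfl
  refine ⟨_, rfl, fun p hp p' hp' e => ?_⟩
  rw [hmap _ _ hp, hmap _ _ hp', e]

theorem map_scope_mem_gac (AV : ViewStr A) {BV : RelStr AV.voc W} {h : V → W}
    (hh : ∀ R, (AV.scope R).map h ∈ BV.rel R) (R : AV.voc.Sym) :
    (AV.scope R).map h ∈ (AV.gac BV).rel R :=
  ⟨_, fun R' => Set.singleton_subset_iff.2 (hh R'), AV.consistent_singleton_map h, rfl⟩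

variable {O : Finset V} (AV : ViewStr A) (dom : {x : V // x ∈ O} → AV.voc.Sym)

theorem propagate_cons (X : {x : V // x ∈ O}) (Xs : List {x : V // x ∈ O})
    (BV : RelStr AV.voc W) (pre : List W) :
    AV.propagate dom (X :: Xs) BV pre = ((AV.gac BV).values (dom X)).val.bind fun a =>
      if Xs.isEmpty then {pre ++ [a]}
      else AV.propagate dom Xs ((AV.gac BV).fix (dom X) a) (pre ++ [a]) :=
  rfl

/-- The witness `C` comes from the last GAC on the branch. Relations only shrink, so the earlier
restrictions to single values persist in it. -/
theorem exists_of_mem_propagate : ∀ (Xs : List {x : V // x ∈ O}) (BV : RelStr AV.voc W)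
    (pre l : List W), l ∈ AV.propagate dom Xs BV pre →
    ∃ C : AV.voc.Sym → Set (List W), AV.Consistent C ∧ (∀ R, C R ⊆ BV.rel R) ∧
      ∃ Ys X as a, Xs = Ys ++ [X] ∧ l = pre ++ (as ++ [a]) ∧ [a] ∈ C (dom X) ∧
        List.Forall₂ (fun Y b => C (dom Y) ⊆ {[b]}) Ys as
  | [], _, _, _, h => absurd h (Multiset.notMem_zero _)
  | X :: Xs, BV, pre, l, h => by
    rw [propagate_cons, Multiset.mem_bind] at h
    obtain ⟨a, ha, hl⟩ := h
    have ha' : [a] ∈ (AV.gac BV).rel (dom X) := (RelStr.mem_values.1 ha)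
    cases Xs with
    | nil =>
      simp only [List.isEmpty_nil, if_true, Multiset.mem_singleton] at hl
      exact ⟨_, AV.gac_consistent BV, AV.gac_rel_subset BV, [], X, [], a, rfl, hl, ha', .nil⟩
    | cons X' Xs =>
      simp only [List.isEmpty_cons, Bool.false_eq_true, if_false] at hl
      obtain ⟨C, hC, hsub, Ys, Z, as, b, hYs, rfl, hb, hall⟩ := exists_of_mem_propagate _ _ _ _ hl
      refine ⟨C, hC, fun R t ht => AV.gac_rel_subset BV R (hsub R ht).1, X :: Ys, Z, a :: as, b,
        by rw [hYs, List.cons_append], by simp, hb, .cons (fun t ht => ?_) hall⟩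
      exact (hsub _ ht).2 rfl

/-- On the branch that follows `h`, both GAC and fixing the value `h X` keep the image of every
scope. -/
theorem map_mem_propagate {h : V → W} (hdom : ∀ X, AV.scope (dom X) = [X.1]) :
    ∀ (Xs : List {x : V // x ∈ O}) (BV : RelStr AV.voc W) (pre : List W), Xs ≠ [] →
      (∀ R, (AV.scope R).map h ∈ BV.rel R) →
      pre ++ Xs.map (fun X => h X.1) ∈ AV.propagate dom Xs BV pre
  | [], _, _, hne, _ => absurd rfl hne
  | X :: Xs, BV, pre, _, hh => by
    have hgac := AV.map_scope_mem_gac hh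
    have hX : [h X.1] ∈ (AV.gac BV).rel (dom X) := by
      have h1 := hgac (dom X)
      rwa [hdom] at h1
    rw [propagate_cons, Multiset.mem_bind]
    refine ⟨h X.1, RelStr.mem_values.2 hX, ?_⟩
    cases Xs with
    | nil => simp
    | cons X' Xs =>
      simp only [List.isEmpty_cons, Bool.false_eq_true, if_false]
      have h1 := map_mem_propagate hdom (X' :: Xs) ((AV.gac BV).fix (dom X) (h X.1))
        (pre ++ [h X.1]) (List.cons_ne_nil _ _) fun R => ⟨hgac R, fun hR => by
          rw [hR, hdom, List.map_singleton]⟩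
      rwa [List.append_assoc] at h1

theorem prefix_of_mem_propagate {Xs : List {x : V // x ∈ O}} {BV : RelStr AV.voc W}
    {pre l : List W} (h : l ∈ AV.propagate dom Xs BV pre) : pre <+: l := by
  obtain ⟨_, _, _, _, _, as, a, _, rfl, _⟩ := AV.exists_of_mem_propagate dom _ _ _ _ h
  exact List.prefix_append _ _

/-- Outputs of different branches extend prefixes of equal length that differ in the last entry. -/
theorem nodup_propagate : ∀ (Xs : List {x : V // x ∈ O}) (BV : RelStr AV.voc W) (pre : List W),
    (AV.propagate dom Xs BV pre).Nodup
  | [], _, _ => Multiset.nodup_zero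
  | X :: Xs, BV, pre => by
    rw [propagate_cons, Multiset.nodup_bind]
    have hpre : ∀ a l, (l ∈ if Xs.isEmpty then {pre ++ [a]}
        else AV.propagate dom Xs ((AV.gac BV).fix (dom X) a) (pre ++ [a])) →
        pre ++ [a] <+: l := by
      intro a l hl
      split_ifs at hl
      · rw [Multiset.mem_singleton.1 hl]
      · exact AV.prefix_of_mem_propagate dom hl
    refine ⟨fun a _ => ?_, ?_⟩
    · split_ifs
      · exact Multiset.nodup_singleton _
      · exact nodup_propagate _ _ _
    · refine Multiset.Nodup.pairwise (fun a _ b _ hab => ?_) (Finset.nodup _)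
      refine Multiset.disjoint_left.2 fun {l} hla hlb => hab ?_
      have h1 := List.prefix_of_prefix_length_le (hpre a l hla) (hpre b l hlb) (by simp)
      have h2 := h1.eq_of_length (by simp)
      simpa using h2

end ViewStr

/-! ### Correctness of the algorithm -/

theorem mainTheorem1 (DM : DecompositionMethod) {τ : Vocabulary} {V : Type} (A : RelStr τ V)
    (hA : A.hypergraph.IsConnected) (O : Finset V) (hO : O ⊆ A.carrier) (hne : O.Nonempty)
    (htp : DM.TPCovered A O) {W : Type} (B : RelStr τ W) (I : DomainRestrictedVersion A B O)
    (hviews : (DM.left A).str.hypergraph.CoveredBy (DM.left I.A₁).str.hypergraph)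
    (Xs : List {x : V // x ∈ O}) (hnodup : Xs.Nodup) (hall : ∀ X, X ∈ Xs) :
    (DM.computeAllSolutions I Xs).Nodup ∧
      {l : List W | l ∈ DM.computeAllSolutions I Xs} =
        (fun s : {x : V // x ∈ O} → W => Xs.map s) '' A.solutionsOn B O := by
  refine ⟨ViewStr.nodup_propagate _ _ _ _ _, Set.Subset.antisymm ?_ ?_⟩
  · intro l hl
    obtain ⟨C, hC, hsub, Ys, X, as, a, rfl, rfl, ha, hYs⟩ :=
      ViewStr.exists_of_mem_propagate _ _ _ _ _ _ hl
    obtain ⟨h, hh, hX, hdom⟩ := htp.exists_isHom hA hO I hviews hC hsub ha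
    refine ⟨fun Y => h Y.1, ⟨h, hh, fun _ => rfl⟩, ?_⟩
    -- The solution obtained from the last value alone takes the earlier chosen values, since
    -- nothing else is left in their domain views.
    have has : Ys.map (fun Y => h Y.1) = as := by
      clear hl hnodup hall
      induction hYs with
      | nil => rfl
      | cons hY _ ih =>
        rw [List.map_cons, ih, List.singleton_injective (Set.mem_singleton_iff.1 (hY (hdom _)))]
    simp [has, hX]
  · rintro _ ⟨s, ⟨h, hh, hs⟩, rfl⟩
    obtain rfl : s = fun X => h X.1 := funext hs
    obtain ⟨x, hx⟩ := hne
    exact ViewStr.map_mem_propagate _ _ (DM.scope_domView I) Xs _ []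
      (List.ne_nil_of_mem (hall ⟨x, hx⟩)) fun R =>
        (DM.legal I.A₁ I.B₁).complete R h (I.isHom hh)
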